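/- Let $G$ be a group with a fixed Garside structure $(G,P,\Delta)$ of finite type. That is, $P\subseteq G$ is a submonoid (of \emph{positive} elements) with $P\cap P^{-1}=\{1\}$ and $\Delta\in P$ such that: the order $a\preccurlyeq b\Leftrightarrow a^{-1}b\in P$ is a lattice order on $G$ (with greatest common divisor $\wedge$); the set $[1,\Delta]=\{a : 1\preccurlyeq a\preccurlyeq\Delta\}$ of simple elements is finite and generates $G$; $\Delta^{-1}P\Delta=P$; and for each $x\in P\setminus\{1\}$ the number of factors in a decomposition of $x$ as a product of elements of $P\setminus\{1\}$ is bounded. For $x,a\in G$ write $x^a=a^{-1}xa$. Let $\inf(x)$ be the largest integer $p$ with $\Delta^p\preccurlyeq x$ and $\sup(x)$ the smallest integer $q$ with $x\preccurlyeq\Delta^q$; let $\iota(x)=x\Delta^{-\inf(x)}\wedge\Delta$ and let $\mathfrak p(x)=\iota(x)\wedge\iota(x^{-1})$ be the preferred prefix of $x$. The cyclic sliding of $x$ is $\mathfrak s(x)=x^{\mathfrak p(x)}$; put $\mathfrak P_i(x)=\mathfrak p(x)\,\mathfrak p(\mathfrak s(x))\cdots\mathfrak p(\mathfrak s^{i-1}(x))$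 for $i\ge 1$ and $\mathfrak P_0(x)=1$. The element $x$ is rigid if $\mathfrak p(x)=1$. The super summit set $\mathrm{SSS}(x)$ is the set of conjugates of $x$ whose infimum is maximal and whose supremum is minimal in the conjugacy class of $x$, and $\mathrm{SC}(x)$ is the set of conjugates $y$ of $x$ with $\mathfrak s^m(y)=y$ for some $m\ge 1$. \textbf{Theorem.} Let $x\in\mathrm{SSS}(x)$ be a super summit element whose conjugacy class contains a rigid element. Then $\mathrm{SC}(x)$ is the set of rigid conjugates of $x$. There is a unique positive element $c(x)$ such that $x^{c(x)}\in\mathrm{SC}(x)$ and $c(x)\preccurlyeq\alpha$ for every positive $\alpha\in G$ with $x^\alpha\in\mathrm{SC}(x)$; equivalently, $c(x)$ is the $\preccurlyeq$-least positive element conjugating $x$ to a rigid element. Moreover, there is an integer $M\ge 0$ such that for all $i\ge M$ one has $\mathfrak P_i(x)=c(x)$, and $\mathfrak s^i(x)=x^{c(x)}$ is rigid. -/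

import Mathlib

/-- A Garside structure `(G, P, Δ)` on a group `G`: a submonoid `P` of positive elements with
`P ∩ P⁻¹ = {1}` and an element `Δ ∈ P`, such that
* `a ≼ b ↔ a⁻¹ b ∈ P` is a lattice order on `G`,
* the simple elements, `1 ≼ a ≼ Δ`, generate `G`,
* `Δ⁻¹ P Δ = P`,
* for each positive `x ≠ 1`, the number of factors in the decompositions of `x` as a product of
  nontrivial positive elements is bounded. -/
structure GarsideStructure (G : Type*) [Group G] where
  P : Submonoid G
  Δ : G
  Δ_mem : Δ ∈ P
  eq_one_of_mem_of_inv_mem : ∀ a : G, a ∈ P → a⁻¹ ∈ P → a = 1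
  exists_gcd : ∀ a b : G, ∃ d : G, d⁻¹ * a ∈ P ∧ d⁻¹ * b ∈ P ∧
    ∀ e : G, e⁻¹ * a ∈ P → e⁻¹ * b ∈ P → e⁻¹ * d ∈ P
  exists_lcm : ∀ a b : G, ∃ m : G, a⁻¹ * m ∈ P ∧ b⁻¹ * m ∈ P ∧
    ∀ e : G, a⁻¹ * e ∈ P → b⁻¹ * e ∈ P → m⁻¹ * e ∈ P
  closure_simple : Subgroup.closure {a : G | a ∈ P ∧ a⁻¹ * Δ ∈ P} = ⊤
  conj_mem_iff : ∀ a : G, Δ⁻¹ * a * Δ ∈ P ↔ a ∈ P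
  bounded_factors : ∀ x : G, x ∈ P → x ≠ 1 → ∃ N : ℕ, ∀ L : List G,
    (∀ a ∈ L, a ∈ P ∧ a ≠ 1) → L.prod = x → L.length ≤ N

namespace GarsideStructure

variable {G : Type*} [Group G] (S : GarsideStructure G)

/-- The prefix order `a ≼ b`. -/
def le (a b : G) : Prop := a⁻¹ * b ∈ S.P

/-- The set `[1, Δ]` of simple elements. -/
def simples : Set G := {a | S.le 1 a ∧ S.le a S.Δ}

/-- The structure is of finite type if there are finitely many simple elements. -/
def FiniteType : Prop := S.simples.Finite

/-- The greatest common divisor `a ∧ b` with respect to `≼`. -/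
noncomputable def gcd (a b : G) : G := Classical.choose (S.exists_gcd a b)

/-- The infimum of `x`: the largest integer `p` with `Δ ^ p ≼ x`. -/
noncomputable def inf (x : G) : ℤ := sSup {p : ℤ | S.le (S.Δ ^ p) x}

/-- The supremum of `x`: the smallest integer `q` with `x ≼ Δ ^ q`. -/
noncomputable def sup (x : G) : ℤ := sInf {q : ℤ | S.le x (S.Δ ^ q)}

/-- The initial factor `ι(x) = x Δ ^ (-inf x) ∧ Δ`. -/
noncomputable def initialFactor (x : G) : G := S.gcd (x * S.Δ ^ (-S.inf x)) S.Δ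

/-- The preferred prefix `𝔭(x) = ι(x) ∧ ι(x⁻¹)`. -/
noncomputable def preferredPrefix (x : G) : G :=
  S.gcd (S.initialFactor x) (S.initialFactor x⁻¹)

/-- The conjugate `x ^ a = a⁻¹ x a`. -/
def conj (x a : G) : G := a⁻¹ * x * a

/-- Cyclic sliding `𝔰(x) = x ^ 𝔭(x)`. -/
noncomputable def sliding (x : G) : G := conj x (S.preferredPrefix x)

/-- `𝔓_i(x) = 𝔭(x) 𝔭(𝔰(x)) ⋯ 𝔭(𝔰^(i-1)(x))`. -/
noncomputable def slidingConjugator (x : G) : ℕ → G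
  | 0 => 1
  | i + 1 => slidingConjugator x i * S.preferredPrefix (S.sliding^[i] x)

/-- `x` is rigid if its preferred prefix is trivial. -/
def IsRigid (x : G) : Prop := S.preferredPrefix x = 1

/-- The super summit set of `x`: the conjugates of `x` whose infimum is maximal and whose supremum
is minimal in the conjugacy class of `x`. -/
def SSS (x : G) : Set G :=
  {y | IsConj x y ∧ (∀ z, IsConj x z → S.inf z ≤ S.inf y) ∧
    (∀ z, IsConj x z → S.sup y ≤ S.sup z)}

/-- The set of sliding circuits of `x`: the conjugates of `x` that are fixed by some positive
power of cyclic sliding. -/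
def SC (x : G) : Set G := {y | IsConj x y ∧ ∃ m : ℕ, 1 ≤ m ∧ S.sliding^[m] y = y}

/-- `c` is a least positive element, with respect to `≼`, conjugating `x` into the set `A`. -/
def IsLeastPositiveConjugator (x : G) (A : Set G) (c : G) : Prop :=
  c ∈ S.P ∧ conj x c ∈ A ∧ ∀ α : G, α ∈ S.P → conj x α ∈ A → S.le c α

/-- `Δ ^ p * x₁ * ⋯ * x_r` is the left normal form of `x`: the `x_i` are simple, different from
`1` and `Δ`, and consecutive ones are left weighted, `∂(x_i) ∧ x_(i+1) = 1`, where
`∂(s) = s⁻¹ Δ`. -/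
def IsLeftNormalForm (p : ℤ) (L : List G) (x : G) : Prop :=
  x = S.Δ ^ p * L.prod ∧ (∀ s ∈ L, s ∈ S.simples ∧ s ≠ 1 ∧ s ≠ S.Δ) ∧
    L.IsChain (fun a b => S.gcd (a⁻¹ * S.Δ) b = 1)

variable {S}

theorem le_trans' {a b c : G} (h : S.le a b) (h' : S.le b c) : S.le a c := by
  have := S.P.mul_mem h h'
  simpa [le, mul_assoc] using this

theorem le_refl' (a : G) : S.le a a := by
  simp [le]

theorem le_antisymm' {a b : G} (h : S.le a b) (h' : S.le b a) : a = b := by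
  have := S.eq_one_of_mem_of_inv_mem (a⁻¹ * b) h (by simpa [le] using h')
  exact inv_mul_eq_one.mp this

theorem mul_le_mul_left_iff' (c : G) {a b : G} : S.le (c * a) (c * b) ↔ S.le a b := by
  simp [le, mul_assoc]

theorem gcd_le_left (a b : G) : S.le (S.gcd a b) a := (Classical.choose_spec (S.exists_gcd a b)).1

theorem gcd_le_right (a b : G) : S.le (S.gcd a b) b :=
  (Classical.choose_spec (S.exists_gcd a b)).2.1

theorem le_gcd {a b e : G} (h : S.le e a) (h' : S.le e b) : S.le e (S.gcd a b) :=
  (Classical.choose_spec (S.exists_gcd a b)).2.2 e h h'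

theorem mul_Δ_le {a b : G} (h : S.le a b) : S.le (a * S.Δ) (b * S.Δ) := by
  have := (S.conj_mem_iff (a⁻¹ * b)).2 h
  simpa [le, mul_assoc] using this

theorem le_of_mul_Δ_le {a b : G} (h : S.le (a * S.Δ) (b * S.Δ)) : S.le a b :=
  (S.conj_mem_iff (a⁻¹ * b)).1 (by simpa [le, mul_assoc] using h)

theorem mul_Δ_pow_le {a b : G} (h : S.le a b) (k : ℕ) :
    S.le (a * S.Δ ^ k) (b * S.Δ ^ k) := by
  induction k with
  | zero => simpa using h
  | succ k ih => simpa [pow_succ, mul_assoc] using mul_Δ_le ih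

theorem le_of_mul_Δ_pow_le {a b : G} (k : ℕ) (h : S.le (a * S.Δ ^ k) (b * S.Δ ^ k)) :
    S.le a b := by
  induction k with
  | zero => simpa using h
  | succ k ih => exact ih (le_of_mul_Δ_le (by simpa [pow_succ, mul_assoc] using h))

theorem Δ_pow_mem (k : ℕ) : S.Δ ^ k ∈ S.P := S.P.pow_mem S.Δ_mem k

theorem le_mul_of_mem (a : G) {b : G} (h : b ∈ S.P) : S.le a (a * b) := by
  simpa [le] using h

theorem Δ_zpow_le_Δ_zpow {m n : ℤ} (h : m ≤ n) : S.le (S.Δ ^ m) (S.Δ ^ n) := by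
  obtain ⟨k, rfl⟩ := Int.le.dest h
  rw [zpow_add, zpow_natCast]
  exact le_mul_of_mem _ (Δ_pow_mem k)

theorem prod_mem_of_simples {L : List G} (h : ∀ s ∈ L, s ∈ S.simples) : L.prod ∈ S.P :=
  S.P.list_prod_mem fun s hs => by simpa [le] using (h s hs).1

theorem prod_le_Δ_pow {L : List G} (h : ∀ s ∈ L, s ∈ S.simples) :
    S.le L.prod (S.Δ ^ L.length) := by
  induction L with
  | nil => simp [le]
  | cons a l ih =>
    have h1 := ih fun s hs => h s (List.mem_cons_of_mem _ hs)
    have h2 := (h a List.mem_cons_self).2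
    have h3 := mul_Δ_pow_le h2 l.length
    rw [List.prod_cons, List.length_cons, pow_succ']
    exact le_trans' ((mul_le_mul_left_iff' a).2 h1) h3

/-- The first factor of a left weighted product is its greatest simple prefix. -/
theorem simple_prefix_le {a : G} {l : List G} (h : ∀ s ∈ a :: l, s ∈ S.simples)
    (hc : (a :: l).IsChain (fun a b => S.gcd (a⁻¹ * S.Δ) b = 1)) {d : G} (hd : S.le d S.Δ)
    (hd' : S.le d (a :: l).prod) : S.le d a := by
  induction l generalizing a d with
  | nil => simpa using hd'
  | cons b l ih =>
    have ha := (h a List.mem_cons_self).2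
    have hl : ∀ s ∈ b :: l, s ∈ S.simples := fun s hs => h s (List.mem_cons_of_mem _ hs)
    obtain ⟨h1, h2⟩ := List.isChain_cons_cons.1 hc
    set D := S.gcd S.Δ (a :: b :: l).prod with hD
    have haD : S.le a D := le_gcd ha (by
      rw [List.prod_cons]; exact le_mul_of_mem _ (prod_mem_of_simples hl))
    have hdD : S.le d D := le_gcd hd hd'
    have e1 : S.le (a⁻¹ * D) (a⁻¹ * S.Δ) := (mul_le_mul_left_iff' a⁻¹).2 (gcd_le_left _ _)
    have e2 : S.le (a⁻¹ * D) (b :: l).prod := by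
      have := (mul_le_mul_left_iff' (S := S) a⁻¹).2 (gcd_le_right (S := S) S.Δ (a :: b :: l).prod)
      rwa [List.prod_cons (a := a), inv_mul_cancel_left, ← List.prod_cons (a := a), ← hD] at this
    have e3 : S.le (a⁻¹ * S.Δ) S.Δ := by
      have := (S.conj_mem_iff a).2 (by simpa [le] using (h a List.mem_cons_self).1)
      simpa [le, mul_assoc] using this
    have e4 : S.le (a⁻¹ * D) b := ih hl h2 (le_trans' e1 e3) e2
    have e5 : S.le (a⁻¹ * D) 1 := h1 ▸ le_gcd e1 e4
    have e6 : S.le D a := by simpa using (mul_le_mul_left_iff' (S := S) a).2 e5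
    exact le_trans' hdD e6

theorem length_le_of_prod_le {L : List G} (h : ∀ s ∈ L, s ∈ S.simples ∧ s ≠ 1)
    (hc : L.IsChain (fun a b => S.gcd (a⁻¹ * S.Δ) b = 1)) {k : ℕ}
    (hk : S.le L.prod (S.Δ ^ k)) : L.length ≤ k := by
  induction k generalizing L with
  | zero =>
    cases L with
    | nil => simp
    | cons a l =>
      exfalso
      have hs : ∀ s ∈ a :: l, s ∈ S.simples := fun s hs => (h s hs).1
      have h1 : S.le a (a :: l).prod := by
        rw [List.prod_cons]
        exact le_mul_of_mem _ (prod_mem_of_simples fun s hs' => hs s (List.mem_cons_of_mem _ hs'))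
      exact (h a List.mem_cons_self).2
        (le_antisymm' (le_trans' h1 (by simpa using hk)) (hs a List.mem_cons_self).1)
  | succ k ih =>
    cases L with
    | nil => simp
    | cons a l =>
      have hs : ∀ s ∈ a :: l, s ∈ S.simples := fun s hs => (h s hs).1
      set y := (a :: l).prod with hy
      have e1 : S.le (S.gcd S.Δ y) a := simple_prefix_le hs hc (gcd_le_left _ _) (gcd_le_right _ _)
      have e2 : S.le (y * (S.Δ ^ k)⁻¹) (S.gcd S.Δ y) := by
        refine le_gcd (le_of_mul_Δ_pow_le k ?_) (le_of_mul_Δ_pow_le k ?_)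
        · simpa [pow_succ'] using hk
        · simpa using le_mul_of_mem y (Δ_pow_mem k)
      have e3 : S.le y (a * S.Δ ^ k) := by
        simpa using mul_Δ_pow_le (le_trans' e2 e1) k
      have e4 : S.le l.prod (S.Δ ^ k) := by
        rw [hy, List.prod_cons] at e3
        exact (mul_le_mul_left_iff' a).1 e3
      have := ih (fun s hs => h s (List.mem_cons_of_mem _ hs)) hc.tail e4
      simpa using this

/-- The infimum and the supremum are read off the left normal form. -/
theorem IsLeftNormalForm.inf_eq_and_sup_eq (hΔ : S.Δ ≠ 1) {p : ℤ} {L : List G} {x : G}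
    (h : S.IsLeftNormalForm p L x) : S.inf x = p ∧ S.sup x = p + L.length := by
  obtain ⟨rfl, hL, hc⟩ := h
  have hs : ∀ s ∈ L, s ∈ S.simples := fun s hs => (hL s hs).1
  constructor
  · refine IsGreatest.csSup_eq ⟨le_mul_of_mem _ (prod_mem_of_simples hs), fun n hn => ?_⟩
    by_contra hlt
    have h1 : S.le (S.Δ ^ (p + 1)) (S.Δ ^ p * L.prod) :=
      le_trans' (Δ_zpow_le_Δ_zpow (by omega)) hn
    rw [zpow_add_one, mul_le_mul_left_iff'] at h1
    cases L with
    | nil => exact hΔ (le_antisymm' (by simpa using h1) (by simpa [le] using S.Δ_mem))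
    | cons a l =>
      have h2 := simple_prefix_le hs hc (le_refl' _) h1
      exact (hL a List.mem_cons_self).2.2 (le_antisymm' (hs a List.mem_cons_self).2 h2)
  · refine IsLeast.csInf_eq ⟨?_, fun n hn => ?_⟩
    · change S.le (S.Δ ^ p * L.prod) (S.Δ ^ (p + (L.length : ℤ)))
      rw [zpow_add, zpow_natCast, mul_le_mul_left_iff']
      exact prod_le_Δ_pow hs
    · have h0 : S.le L.prod (S.Δ ^ (n - p)) := by
        have := (mul_le_mul_left_iff' (S := S) (S.Δ ^ (-p))).2 hn
        rw [sub_eq_neg_add, zpow_add]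
        simpa using this
      rcases le_or_gt p n with hpn | hpn
      · obtain ⟨k, hk⟩ := Int.eq_ofNat_of_zero_le (sub_nonneg.2 hpn)
        rw [hk, zpow_natCast] at h0
        have := length_le_of_prod_le (fun s hs => ⟨(hL s hs).1, (hL s hs).2.1⟩) hc h0
        omega
      · exfalso
        have h1 : S.le 1 (S.Δ ^ (-1 : ℤ)) :=
          le_trans' (le_trans' (by simpa [le] using prod_mem_of_simples hs) h0)
            (Δ_zpow_le_Δ_zpow (by omega))
        exact hΔ (S.eq_one_of_mem_of_inv_mem _ S.Δ_mem (by simpa [le] using h1))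

end GarsideStructure

/-!
Write `x ^ a = a⁻¹ x a`, and let `x` have maximal infimum and minimal supremum in its class. If `α`
is positive and `x ^ α` is rigid, then `α = α 𝔭(x ^ α)` is the greatest common divisor of
`x α Δ ^ (-p)`, `α Δ` and `x⁻¹ α Δ ^ q` with `p = inf (x ^ α) ≤ inf x` and
`q = sup (x ^ α) ≥ sup x`; these are multiples of the three elements whose greatest common divisor
is `𝔭(x)`, and so `𝔭(x) ≼ α` (`IsSummit.preferredPrefix_le`). Sliding preserves the hypothesis on
`x`, hence `𝔓_i(x) ≼ α` for all `i`, and the bound on the number of factors forces some `𝔰^M(x)` to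
be rigid. From there on the sequence is constant, and `𝔓_M(x)` is the least conjugator.

The same argument shows that elements of sliding circuits are rigid, once they are known to have
maximal infimum and minimal supremum; by passing to inverses, the infimum is enough. Fix `p`, `q`
and use them in place of `inf` and `sup` in the definitions of sliding, cycling and their prefixes.
Then
* sliding and cycling commute (`slidingIn_cyclingIn`);
* if some conjugate of `y` has infimum above `p`, then so has an iterated cycling of `y`
  (`exists_Δ_zpow_le_iterate_cyclingIn`);
* if `y` lies between `Δ ^ p` and `Δ ^ q` and its cycling has infimum above `p`, then so has
  `𝔰²(y)` (`Δ_zpow_le_slidingIn_slidingIn`).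

If `y` is in a circuit but its infimum `p` is not maximal, consider the last iterated cycling of `y`
before the infimum first rises. It is periodic under sliding like `y`, although two slidings raise
its infimum, and sliding never lowers an infimum: a contradiction.
-/

namespace GarsideStructure

variable {G : Type*} [Group G] {S : GarsideStructure G}

/-! ### The lattice order and powers of `Δ` -/

theorem one_le_iff {a : G} : S.le 1 a ↔ a ∈ S.P := by simp [le]

theorem mul_Δ_zpow_le_iff (n : ℤ) {a b : G} :
    S.le (a * S.Δ ^ n) (b * S.Δ ^ n) ↔ S.le a b := by
  have key : ∀ (k : ℕ) (a b : G), S.le (a * S.Δ ^ k) (b * S.Δ ^ k) ↔ S.le a b :=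
    fun k a b => ⟨le_of_mul_Δ_pow_le k, fun h => mul_Δ_pow_le h k⟩
  obtain ⟨k, rfl | rfl⟩ := n.eq_nat_or_neg
  · simpa using key k a b
  · simpa using (key k (a * S.Δ ^ (-(k : ℤ))) (b * S.Δ ^ (-(k : ℤ)))).symm

theorem le_mul_Δ_zpow_iff (n : ℤ) {a b : G} :
    S.le a (b * S.Δ ^ n) ↔ S.le (a * S.Δ ^ (-n)) b := by
  rw [← mul_Δ_zpow_le_iff (-n)]
  simp

theorem mul_le_iff (c : G) {a b : G} : S.le (c * a) b ↔ S.le a (c⁻¹ * b) := by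
  simp [le, mul_assoc]

theorem le_mul_iff (c : G) {a b : G} : S.le a (c * b) ↔ S.le (c⁻¹ * a) b := by
  simp [le, mul_assoc]

theorem le_gcd_iff {a b e : G} : S.le e (S.gcd a b) ↔ S.le e a ∧ S.le e b :=
  ⟨fun h => ⟨le_trans' h (gcd_le_left _ _), le_trans' h (gcd_le_right _ _)⟩,
    fun h => le_gcd h.1 h.2⟩

theorem eq_of_forall_le_iff {a b : G} (h : ∀ e, S.le e a ↔ S.le e b) : a = b :=
  le_antisymm' ((h a).1 (le_refl' a)) ((h b).2 (le_refl' b))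

theorem gcd_mul_left (c a b : G) : S.gcd (c * a) (c * b) = c * S.gcd a b :=
  eq_of_forall_le_iff (S := S) fun e => by simp only [le_gcd_iff, le_mul_iff]

theorem gcd_mul_Δ_zpow (n : ℤ) (a b : G) :
    S.gcd (a * S.Δ ^ n) (b * S.Δ ^ n) = S.gcd a b * S.Δ ^ n :=
  eq_of_forall_le_iff (S := S) fun e => by simp only [le_gcd_iff, le_mul_Δ_zpow_iff]

theorem gcd_mul_Δ (a b : G) : S.gcd (a * S.Δ) (b * S.Δ) = S.gcd a b * S.Δ := by
  simpa using gcd_mul_Δ_zpow (S := S) 1 a b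

theorem gcd_comm' (a b : G) : S.gcd a b = S.gcd b a :=
  eq_of_forall_le_iff (S := S) fun e => by simp only [le_gcd_iff, and_comm]

theorem le_mul_Δ_zpow_of_mem {a b : G} (n : ℤ) (hb : b ∈ S.P) :
    S.le (a * S.Δ ^ n) (a * b * S.Δ ^ n) :=
  (mul_Δ_zpow_le_iff n).2 (le_mul_of_mem a hb)

theorem conj_mul (x a b : G) : conj x (a * b) = conj (conj x a) b := by
  simp [conj, mul_assoc]

theorem conj_inv (x a : G) : conj x⁻¹ a = (conj x a)⁻¹ := by
  simp [conj, mul_assoc]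

theorem mul_conj (x a : G) : a * conj x a = x * a := by
  simp [conj, mul_assoc]

theorem isConj_conj (x a : G) : IsConj x (conj x a) :=
  isConj_iff.2 ⟨a⁻¹, by simp [conj]⟩

theorem exists_conj_eq {x y : G} (h : IsConj x y) : ∃ a, conj x a = y := by
  obtain ⟨c, rfl⟩ := isConj_iff.1 h
  exact ⟨c⁻¹, by simp [conj]⟩

theorem Δ_zpow_le_conj_iff {x a : G} {p : ℤ} :
    S.le (S.Δ ^ p) (conj x a) ↔ S.le (a * S.Δ ^ p) (x * a) := by
  rw [← mul_le_mul_left_iff' a, mul_conj]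

theorem conj_le_Δ_zpow_iff {x a : G} {q : ℤ} :
    S.le (conj x a) (S.Δ ^ q) ↔ S.le (x * a) (a * S.Δ ^ q) := by
  rw [← mul_le_mul_left_iff' a, mul_conj]

theorem Δ_zpow_le_conj_Δ_zpow_iff {x : G} {p n : ℤ} :
    S.le (S.Δ ^ p) (conj x (S.Δ ^ n)) ↔ S.le (S.Δ ^ p) x := by
  rw [Δ_zpow_le_conj_iff, ← zpow_add, add_comm, zpow_add, mul_Δ_zpow_le_iff]

theorem Δ_zpow_le_inv_iff {x : G} {p : ℤ} :
    S.le (S.Δ ^ p) x⁻¹ ↔ S.le x (S.Δ ^ (-p)) := by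
  rw [← mul_le_mul_left_iff' x, mul_inv_cancel, ← mul_Δ_zpow_le_iff (-p)]
  simp

/-! ### Infimum and supremum -/

/-- Every element lies below a power of `Δ`; this uses that the simple elements generate. -/
theorem exists_le_Δ_zpow (x : G) : ∃ q : ℤ, S.le x (S.Δ ^ q) := by
  have hx : x ∈ Subgroup.closure {a : G | a ∈ S.P ∧ a⁻¹ * S.Δ ∈ S.P} :=
    S.closure_simple ▸ Subgroup.mem_top x
  induction hx using Subgroup.closure_induction_left with
  | one => exact ⟨0, by simp [le]⟩
  | mul_left a ha y _ ih =>
    obtain ⟨q, hq⟩ := ih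
    refine ⟨1 + q, le_trans' ((mul_le_mul_left_iff' a).2 hq) ?_⟩
    rw [zpow_add, mul_Δ_zpow_le_iff, zpow_one]
    exact ha.2
  | inv_mul_cancel a ha y _ ih =>
    obtain ⟨q, hq⟩ := ih
    refine ⟨q, le_trans' ((mul_le_mul_left_iff' a⁻¹).2 hq) ?_⟩
    rw [mul_le_iff, inv_inv]
    have := (mul_Δ_zpow_le_iff (S := S) q).2 (one_le_iff.2 ha.1)
    simpa using this

theorem exists_Δ_zpow_le (x : G) : ∃ p : ℤ, S.le (S.Δ ^ p) x := by
  obtain ⟨q, hq⟩ := exists_le_Δ_zpow (S := S) x⁻¹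
  exact ⟨-q, by simpa using (Δ_zpow_le_inv_iff (S := S) (x := x⁻¹) (p := -q)).2 (by simpa using hq)⟩

theorem le_of_Δ_zpow_le_Δ_zpow (hΔ : S.Δ ≠ 1) {m n : ℤ} (h : S.le (S.Δ ^ m) (S.Δ ^ n)) :
    m ≤ n := by
  by_contra hlt
  have h1 : S.le (S.Δ ^ (n + 1)) (S.Δ ^ n) := le_trans' (Δ_zpow_le_Δ_zpow (by omega)) h
  rw [zpow_add, zpow_one, mul_le_iff, inv_mul_cancel] at h1
  exact hΔ (le_antisymm' h1 (one_le_iff.2 S.Δ_mem))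

theorem Δ_zpow_le_iff (hΔ : S.Δ ≠ 1) {x : G} {p : ℤ} :
    S.le (S.Δ ^ p) x ↔ p ≤ S.inf x := by
  obtain ⟨q, hq⟩ := exists_le_Δ_zpow (S := S) x
  have hbdd : BddAbove {p : ℤ | S.le (S.Δ ^ p) x} :=
    ⟨q, fun n hn => le_of_Δ_zpow_le_Δ_zpow hΔ (le_trans' hn hq)⟩
  refine ⟨fun h => le_csSup hbdd h, fun h => le_trans' (Δ_zpow_le_Δ_zpow h) ?_⟩
  exact Int.csSup_mem (exists_Δ_zpow_le x) hbdd

theorem le_Δ_zpow_iff_neg_inf_inv_le (hΔ : S.Δ ≠ 1) {x : G} {q : ℤ} :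
    S.le x (S.Δ ^ q) ↔ -S.inf x⁻¹ ≤ q := by
  rw [neg_le, ← Δ_zpow_le_iff hΔ, Δ_zpow_le_inv_iff, neg_neg]

theorem inf_inv_eq_neg_sup (hΔ : S.Δ ≠ 1) (x : G) : S.inf x⁻¹ = -S.sup x := by
  have h : S.sup x = -S.inf x⁻¹ :=
    IsLeast.csInf_eq ⟨(le_Δ_zpow_iff_neg_inf_inv_le hΔ).2 le_rfl,
      fun q hq => (le_Δ_zpow_iff_neg_inf_inv_le hΔ).1 hq⟩
  rw [h, neg_neg]

theorem inf_conj_Δ_zpow (x : G) (n : ℤ) : S.inf (conj x (S.Δ ^ n)) = S.inf x := by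
  simp only [inf, Δ_zpow_le_conj_Δ_zpow_iff]

theorem subsingleton_of_Δ_eq_one (hΔ : S.Δ = 1) : Subsingleton G := by
  refine ⟨fun a b => ?_⟩
  have h : ∀ x : G, x = 1 := fun x => by
    obtain ⟨p, hp⟩ := exists_Δ_zpow_le (S := S) x
    obtain ⟨q, hq⟩ := exists_le_Δ_zpow (S := S) x
    rw [hΔ, one_zpow] at hp hq
    exact le_antisymm' hq hp
  rw [h a, h b]

/-- Any element becomes positive after right multiplication by a power of `Δ`. -/
theorem exists_mul_Δ_pow_mem (a : G) : ∃ k : ℕ, a * S.Δ ^ k ∈ S.P := by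
  obtain ⟨p, hp⟩ := exists_Δ_zpow_le (S := S) a
  refine ⟨(-p).toNat, ?_⟩
  rw [← one_le_iff, ← zpow_natCast, le_mul_Δ_zpow_iff, one_mul]
  exact le_trans' (Δ_zpow_le_Δ_zpow (by omega)) hp

/-- The bound on the number of factors holds for every prefix of a given positive element. -/
theorem exists_length_le_of_prod_le {x : G} (hx : x ∈ S.P) : ∃ N : ℕ, ∀ L : List G,
    (∀ a ∈ L, a ∈ S.P ∧ a ≠ 1) → S.le L.prod x → L.length ≤ N := by
  by_cases h1 : x = 1
  · subst h1
    refine ⟨0, fun L hL h => ?_⟩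
    cases L with
    | nil => simp
    | cons a l =>
      have hl : l.prod ∈ S.P :=
        S.P.list_prod_mem fun b hb => (hL b (List.mem_cons_of_mem _ hb)).1
      have ha := hL a List.mem_cons_self
      rw [List.prod_cons] at h
      exact absurd (le_antisymm' (le_trans' (le_mul_of_mem a hl) h) (one_le_iff.2 ha.1)) ha.2
  · obtain ⟨N, hN⟩ := S.bounded_factors x hx h1
    refine ⟨N, fun L hL h => ?_⟩
    by_cases hr : L.prod⁻¹ * x = 1
    · exact hN L hL (inv_mul_eq_one.1 hr)
    · have := hN (L ++ [L.prod⁻¹ * x]) (by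
        intro a ha
        rcases List.mem_append.1 ha with ha | ha
        · exact hL a ha
        · rw [List.mem_singleton.1 ha]
          exact ⟨h, hr⟩) (by simp)
      simp at this
      omega

/-! ### Sliding and cycling relative to an interval of powers of `Δ` -/

variable (S)

/-- `Δ ^ p ≼ y ≼ Δ ^ q`. -/
def InRange (p q : ℤ) (y : G) : Prop := S.le (S.Δ ^ p) y ∧ S.le y (S.Δ ^ q)

/-- The initial factor `y Δ ^ (-p) ∧ Δ` computed with a prescribed integer `p` in place of
`inf y`. -/
noncomputable def initialIn (p : ℤ) (y : G) : G := S.gcd (y * S.Δ ^ (-p)) S.Δ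

/-- The preferred prefix `y Δ ^ (-p) ∧ Δ ∧ y⁻¹ Δ ^ q` computed with prescribed integers `p`, `q` in
place of `inf y`, `sup y`. -/
noncomputable def prefixIn (p q : ℤ) (y : G) : G :=
  S.gcd (S.initialIn p y) (y⁻¹ * S.Δ ^ q)

/-- Cycling relative to a prescribed integer `p`: conjugation by `initialIn p`. -/
noncomputable def cyclingIn (p : ℤ) (y : G) : G := conj y (S.initialIn p y)

/-- Cyclic sliding relative to prescribed integers `p`, `q`: conjugation by `prefixIn p q`. -/
noncomputable def slidingIn (p q : ℤ) (y : G) : G := conj y (S.prefixIn p q y)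

variable {S}

theorem le_prefixIn_iff {p q : ℤ} {y e : G} : S.le e (S.prefixIn p q y) ↔
    S.le e (y * S.Δ ^ (-p)) ∧ S.le e S.Δ ∧ S.le e (y⁻¹ * S.Δ ^ q) := by
  simp only [prefixIn, initialIn, le_gcd_iff, and_assoc]

theorem le_initialIn_iff {p : ℤ} {y e : G} : S.le e (S.initialIn p y) ↔
    S.le e (y * S.Δ ^ (-p)) ∧ S.le e S.Δ := by
  simp only [initialIn, le_gcd_iff]

theorem preferredPrefix_eq_prefixIn (y : G) :
    S.preferredPrefix y = S.prefixIn (S.inf y) (-S.inf y⁻¹) y := by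
  refine eq_of_forall_le_iff (S := S) fun e => ?_
  simp only [preferredPrefix, initialFactor, le_prefixIn_iff, le_gcd_iff]
  tauto

/-- The elements conjugating `y` into a given range are closed under greatest common divisors. -/
theorem InRange.conj_gcd {p q : ℤ} {y a b : G} (ha : S.InRange p q (conj y a))
    (hb : S.InRange p q (conj y b)) : S.InRange p q (conj y (S.gcd a b)) := by
  simp only [InRange, Δ_zpow_le_conj_iff, conj_le_Δ_zpow_iff] at *
  rw [← gcd_mul_left, ← gcd_mul_Δ_zpow, ← gcd_mul_Δ_zpow, le_gcd_iff, le_gcd_iff]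
  exact ⟨⟨le_trans' (gcd_le_left _ _) ha.1, le_trans' (gcd_le_right _ _) hb.1⟩,
    ⟨le_trans' (gcd_le_left _ _) ha.2, le_trans' (gcd_le_right _ _) hb.2⟩⟩

theorem InRange.conj_Δ_zpow {p q : ℤ} {y : G} (h : S.InRange p q y) (n : ℤ) :
    S.InRange p q (conj y (S.Δ ^ n)) := by
  refine ⟨Δ_zpow_le_conj_Δ_zpow_iff.2 h.1, ?_⟩
  rw [conj_le_Δ_zpow_iff, ← zpow_add, add_comm, zpow_add, mul_Δ_zpow_le_iff]
  exact h.2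

theorem InRange.cyclingIn {p q : ℤ} {y : G} (h : S.InRange p q y) (p' : ℤ) :
    S.InRange p q (S.cyclingIn p' y) := by
  refine InRange.conj_gcd ?_ (by simpa using h.conj_Δ_zpow 1)
  rw [conj_mul, show conj y y = y by simp [conj]]
  exact h.conj_Δ_zpow _

theorem InRange.slidingIn {p q : ℤ} {y : G} (h : S.InRange p q y) (p' q' : ℤ) :
    S.InRange p q (S.slidingIn p' q' y) := by
  refine InRange.conj_gcd (h.cyclingIn p') ?_
  rw [conj_mul, show conj y y⁻¹ = y by simp [conj]]
  exact h.conj_Δ_zpow _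

theorem InRange.iterate_slidingIn {p q : ℤ} {y : G} (h : S.InRange p q y) (p' q' : ℤ) (n : ℕ) :
    S.InRange p q ((S.slidingIn p' q')^[n] y) := by
  induction n with
  | zero => exact h
  | succ n ih => rw [Function.iterate_succ_apply']; exact ih.slidingIn p' q'

theorem InRange.iterate_cyclingIn {p q : ℤ} {y : G} (h : S.InRange p q y) (p' : ℤ) (n : ℕ) :
    S.InRange p q ((S.cyclingIn p')^[n] y) := by
  induction n with
  | zero => exact h
  | succ n ih => rw [Function.iterate_succ_apply']; exact ih.cyclingIn p'

theorem mul_prefixIn_conj (p q : ℤ) (y b : G) : b * S.prefixIn p q (conj y b) =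
    S.gcd (S.gcd (y * b * S.Δ ^ (-p)) (b * S.Δ)) (y⁻¹ * b * S.Δ ^ q) := by
  rw [prefixIn, initialIn, ← gcd_mul_left, ← gcd_mul_left, ← mul_assoc, ← mul_assoc, mul_conj,
    ← conj_inv, mul_conj]

/-- The initial factor is transported along sliding to the initial factor: both sides are the
greatest common divisor of the transports of `y Δ ^ (-p)` and of `Δ`. -/
theorem initialIn_mul_prefixIn (p q : ℤ) (y : G) :
    S.initialIn p y * S.prefixIn p q (S.cyclingIn p y) =
      S.prefixIn p q y * S.initialIn p (S.slidingIn p q y) := by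
  have h1 : S.prefixIn p q y * S.initialIn p (S.slidingIn p q y) =
      S.gcd (y * S.prefixIn p q y * S.Δ ^ (-p)) (S.prefixIn p q y * S.Δ ^ (1 : ℤ)) := by
    rw [initialIn, ← gcd_mul_left, ← mul_assoc, slidingIn, mul_conj, zpow_one]
  have h2 : S.initialIn p y * S.prefixIn p q (S.cyclingIn p y) =
      S.gcd (S.gcd (y * S.initialIn p y * S.Δ ^ (-p)) (S.initialIn p y * S.Δ ^ (1 : ℤ)))
        (y⁻¹ * S.initialIn p y * S.Δ ^ q) := by
    rw [zpow_one]
    exact mul_prefixIn_conj p q y _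
  rw [h1, h2]
  refine eq_of_forall_le_iff (S := S) fun e => ?_
  have c1 : S.Δ * S.Δ ^ (-p) = S.Δ ^ (-p) * S.Δ := mul_self_zpow _ _ |>.trans (by simp [zpow_add])
  have c2 : S.Δ * S.Δ ^ q = S.Δ ^ q * S.Δ := mul_self_zpow _ _ |>.trans (by simp [zpow_add])
  have c3 : S.Δ ^ q * S.Δ ^ (-p) = S.Δ ^ (-p) * S.Δ ^ q := by rw [← zpow_add, ← zpow_add, add_comm]
  simp only [initialIn, prefixIn, ← gcd_mul_left, ← gcd_mul_Δ_zpow, ← gcd_mul_Δ,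
    le_gcd_iff, mul_assoc,
    zpow_one, c1, c2, c3, mul_inv_cancel_left, inv_mul_cancel_left]
  tauto

theorem slidingIn_cyclingIn (p q : ℤ) :
    Function.Commute (S.slidingIn p q) (S.cyclingIn p) := fun y => by
  rw [slidingIn, cyclingIn, ← conj_mul, ← cyclingIn, initialIn_mul_prefixIn, conj_mul]
  rfl

theorem prefixIn_mem {p q : ℤ} {y : G} (h : S.InRange p q y) : S.prefixIn p q y ∈ S.P := by
  rw [← one_le_iff, le_prefixIn_iff, le_mul_Δ_zpow_iff, neg_neg, one_mul]
  refine ⟨h.1, one_le_iff.2 S.Δ_mem, ?_⟩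
  rw [le_mul_iff, inv_inv, mul_one]
  exact h.2

/-- If cycling raises the infimum of `y` above `p`, then, for `u = slidingIn p q y`, the condition
of being a prefix of `u Δ ^ (-p)` is redundant in `prefixIn p q u = u Δ ^ (-p) ∧ Δ ∧ u⁻¹ Δ ^ q`. -/
theorem gcd_Δ_le_of_cyclingIn {p q : ℤ} {y : G}
    (hc : S.le (S.Δ ^ (p + 1)) (S.cyclingIn p y)) :
    S.le (S.gcd S.Δ ((S.slidingIn p q y)⁻¹ * S.Δ ^ q)) (S.slidingIn p q y * S.Δ ^ (-p)) := by
  set u := S.slidingIn p q y with hu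
  -- `γ` conjugates `u` to the cycling of `y`
  set γ := (S.prefixIn p q y)⁻¹ * S.initialIn p y with hγ
  have hγP : γ ∈ S.P := gcd_le_left _ _
  have hz : conj u γ = S.cyclingIn p y := by
    rw [hu, slidingIn, ← conj_mul, hγ, mul_inv_cancel_left]; rfl
  have hι : γ * S.prefixIn p q (conj u γ) = S.initialIn p u := by
    rw [hz, hγ, mul_assoc, initialIn_mul_prefixIn, inv_mul_cancel_left]
  have hle : S.le (γ * S.Δ) (u * γ * S.Δ ^ (-p)) := by
    rw [← hz, Δ_zpow_le_conj_iff] at hc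
    rw [le_mul_Δ_zpow_iff, neg_neg, mul_assoc, ← zpow_one_add, add_comm]
    exact hc
  have hΔ : S.le S.Δ (γ * S.Δ) := by
    simpa using (mul_Δ_zpow_le_iff (S := S) 1).2 (one_le_iff.2 hγP)
  refine le_trans' (b := S.initialIn p u) ?_ (gcd_le_left _ _)
  rw [← hι, mul_prefixIn_conj, le_gcd_iff, le_gcd_iff]
  have h1 := le_trans' (gcd_le_left S.Δ (u⁻¹ * S.Δ ^ q)) hΔ
  exact ⟨⟨le_trans' h1 hle, h1⟩, le_trans' (gcd_le_right _ _) (le_mul_Δ_zpow_of_mem q hγP)⟩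

/-- If the prefix `Δ ∧ u⁻¹ Δ ^ q` is also a prefix of `u Δ ^ (-p)`, then sliding raises the
infimum of `u` above `p`. -/
theorem Δ_zpow_le_slidingIn_of_gcd_le {p q : ℤ} {u : G} (hpq : p + 2 ≤ q)
    (h : S.le (S.gcd S.Δ (u⁻¹ * S.Δ ^ q)) (u * S.Δ ^ (-p))) :
    S.le (S.Δ ^ (p + 1)) (S.slidingIn p q u) := by
  have hη : S.prefixIn p q u = S.gcd S.Δ (u⁻¹ * S.Δ ^ q) := by
    refine eq_of_forall_le_iff (S := S) fun e => ?_
    rw [le_prefixIn_iff, le_gcd_iff]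
    exact ⟨fun he => he.2, fun he => ⟨le_trans' (le_gcd_iff.2 he) h, he⟩⟩
  rw [slidingIn, Δ_zpow_le_conj_iff, hη]
  set η := S.gcd S.Δ (u⁻¹ * S.Δ ^ q) with hη'
  rw [le_mul_iff]
  conv_rhs => rw [hη']
  rw [le_gcd_iff]
  constructor
  · rw [mul_le_iff, inv_inv, zpow_add, zpow_one, ← mul_assoc]
    have := mul_Δ_le ((le_mul_Δ_zpow_iff (-p)).1 h)
    simpa using this
  · rw [mul_le_mul_left_iff']
    refine le_trans' ((mul_Δ_zpow_le_iff (p + 1)).2 (gcd_le_left _ _ : S.le η S.Δ)) ?_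
    rw [← zpow_one_add]
    exact Δ_zpow_le_Δ_zpow (by omega)

/-- If cycling raises the infimum of `y`, so do two slidings. -/
theorem Δ_zpow_le_slidingIn_slidingIn {p q : ℤ} {y : G} (h : S.InRange p q y)
    (hc : S.le (S.Δ ^ (p + 1)) (S.cyclingIn p y)) :
    S.le (S.Δ ^ (p + 1)) (S.slidingIn p q (S.slidingIn p q y)) := by
  by_cases hpq : p + 2 ≤ q
  · exact Δ_zpow_le_slidingIn_of_gcd_le hpq (gcd_Δ_le_of_cyclingIn hc)
  -- for `q ≤ p + 1` the infimum of `y` itself exceeds `p`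
  suffices hy : S.le (S.Δ ^ (p + 1)) y from
    (InRange.iterate_slidingIn ⟨hy, h.2⟩ p q 2).1
  have hz : S.cyclingIn p y = S.Δ ^ (p + 1) := le_antisymm'
    (le_trans' (h.cyclingIn p).2 (Δ_zpow_le_Δ_zpow (by omega))) hc
  have hι : S.initialIn p y = y * S.Δ ^ (-p) := by
    refine eq_of_forall_le_iff (S := S) fun e => ?_
    rw [le_initialIn_iff]
    refine ⟨fun he => he.1, fun he => ⟨he, le_trans' he ?_⟩⟩
    have := (mul_Δ_zpow_le_iff (-p)).2 (le_trans' h.2 (Δ_zpow_le_Δ_zpow (by omega : q ≤ p + 1)))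
    rwa [← zpow_add, show p + 1 + -p = 1 by ring, zpow_one] at this
  have h1 : S.Δ ^ p * y * S.Δ ^ (-p) = S.Δ ^ (p + 1) := by
    rw [← hz, cyclingIn, hι]
    simp [conj, mul_assoc]
  have h2 : y = S.Δ ^ (-p) * (S.Δ ^ p * y * S.Δ ^ (-p)) * S.Δ ^ p := by simp [mul_assoc]
  rw [h2, h1, ← zpow_add, ← zpow_add]
  exact Δ_zpow_le_Δ_zpow (by omega)

/-! ### Raising the infimum by cycling, and periodic points of sliding -/

/-- If a positive conjugator raises the infimum of `y` above `p`, iterated cycling does so too. A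
conjugator `β` with `β ≼ Δ ^ k` turns, along one cycling, into the conjugator
`(ι⁻¹ Δ) (Δ⁻¹ β Δ)`, again below `Δ ^ k`. As long as cycling does not succeed, `ι⁻¹ Δ ≠ 1`, and so
the number of factors of the conjugator grows, which is possible only a bounded number of times. -/
theorem exists_Δ_zpow_le_iterate_cyclingIn {p : ℤ} {y α : G} (hα : α ∈ S.P)
    (h : S.le (S.Δ ^ (p + 1)) (conj y α)) :
    ∃ j : ℕ, S.le (S.Δ ^ (p + 1)) ((S.cyclingIn p)^[j] y) := by
  by_contra! hno
  obtain ⟨k, hk⟩ := exists_le_Δ_zpow (S := S) α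
  obtain ⟨N, hN⟩ := exists_length_le_of_prod_le (S := S) (x := S.Δ ^ k)
    (one_le_iff.1 (le_trans' (one_le_iff.2 hα) hk))
  have key : ∀ i : ℕ, ∃ (L : List G) (δ : G), L.length = i ∧ (∀ a ∈ L, a ∈ S.P ∧ a ≠ 1) ∧
      δ ∈ S.P ∧ S.le (L.prod * δ) (S.Δ ^ k) ∧
      S.le (S.Δ ^ (p + 1)) (conj ((S.cyclingIn p)^[i] y) (L.prod * δ)) := by
    intro i
    induction i with
    | zero => exact ⟨[], α, rfl, by simp, hα, by simpa using hk, by simpa using h⟩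
    | succ i ih =>
      obtain ⟨L, δ, hl, hL, hδ, hβk, hβ⟩ := ih
      have hni := hno i
      rw [Function.iterate_succ_apply']
      set w := (S.cyclingIn p)^[i] y
      set β := L.prod * δ with hβdef
      set ι := S.initialIn p w with hι
      have hιΔ : S.le ι S.Δ := (le_initialIn_iff.1 (le_refl' ι)).2
      have hprod : ((ι⁻¹ * S.Δ) :: L.map (MulAut.conj S.Δ⁻¹)).prod * (S.Δ⁻¹ * δ * S.Δ) =
          ι⁻¹ * β * S.Δ := by
        rw [List.prod_cons, ← map_list_prod, hβdef]
        simp [mul_assoc]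
      refine ⟨(ι⁻¹ * S.Δ) :: L.map (MulAut.conj S.Δ⁻¹), S.Δ⁻¹ * δ * S.Δ, by simp [hl], ?_,
        (S.conj_mem_iff δ).2 hδ, ?_, ?_⟩
      · intro a ha
        rcases List.mem_cons.1 ha with rfl | ha
        · refine ⟨hιΔ, fun h1 => hni ?_⟩
          have h2 : S.le S.Δ (w * S.Δ ^ (-p)) :=
            (le_initialIn_iff.1 ((inv_mul_eq_one.1 h1) ▸ le_refl' ι : S.le S.Δ ι)).1
          rwa [le_mul_Δ_zpow_iff, neg_neg, ← zpow_one_add, add_comm] at h2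
        · obtain ⟨b, hb, rfl⟩ := List.mem_map.1 ha
          refine ⟨?_, (EmbeddingLike.map_ne_one_iff).2 (hL b hb).2⟩
          simpa using (S.conj_mem_iff b).2 (hL b hb).1
      · have h1 : S.le (β * S.Δ ^ (1 - k)) ι := by
          rw [hι, le_initialIn_iff, le_mul_Δ_zpow_iff]
          constructor
          · rw [mul_assoc, ← zpow_add, show 1 - k + - -p = (p + 1) + -k by ring, zpow_add,
              ← mul_assoc, ← le_mul_Δ_zpow_iff]
            exact le_trans' (Δ_zpow_le_conj_iff.1 hβ) ((mul_le_mul_left_iff' w).2 hβk)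
          · have := (mul_Δ_zpow_le_iff (1 - k)).2 hβk
            rwa [← zpow_add, add_sub_cancel, zpow_one] at this
        rw [hprod, mul_assoc, mul_le_iff, inv_inv, le_mul_Δ_zpow_iff, mul_assoc, ← zpow_one_add]
        exact h1
      · have h2 : conj (S.cyclingIn p w) (ι⁻¹ * β * S.Δ) = conj (conj w β) (S.Δ ^ (1 : ℤ)) := by
          rw [cyclingIn, ← hι, ← conj_mul, ← conj_mul, zpow_one, mul_assoc, mul_inv_cancel_left]
        rw [hprod, h2, Δ_zpow_le_conj_Δ_zpow_iff]
        exact hβ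
  obtain ⟨L, δ, hl, hL, hδ, hle, -⟩ := key (N + 1)
  have := hN L hL (le_trans' (le_mul_of_mem _ hδ) hle)
  omega

/-- A periodic point of sliding has infimum above `p` as soon as one of its conjugates has: in the
first cycling that raises the infimum, the point before it is periodic too, because sliding and
cycling commute, and two slidings raise its infimum. -/
theorem Δ_zpow_le_of_iterate_slidingIn_eq {p q : ℤ} {y α : G} (h : S.InRange p q y) {m : ℕ}
    (hm : 1 ≤ m) (hy : (S.slidingIn p q)^[m] y = y) (hα : α ∈ S.P)
    (hle : S.le (S.Δ ^ (p + 1)) (conj y α)) : S.le (S.Δ ^ (p + 1)) y := by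
  classical
  have hex := exists_Δ_zpow_le_iterate_cyclingIn hα hle
  rcases hj : Nat.find hex with - | j
  · simpa [hj] using Nat.find_spec hex
  exfalso
  refine Nat.find_min hex (m := j) (by omega) ?_
  have hspec := Nat.find_spec hex
  rw [hj, Function.iterate_succ_apply'] at hspec
  set w := (S.cyclingIn p)^[j] y with hw
  have hwr : S.InRange p q w := h.iterate_cyclingIn p j
  have hper : (S.slidingIn p q)^[m] w = w := by
    rw [hw, ((slidingIn_cyclingIn p q).iterate_iterate m j) y, hy]
  have hper2 : (S.slidingIn p q)^[(m + m - 2) + 2] w = w := by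
    rw [show m + m - 2 + 2 = m + m by omega, Function.iterate_add_apply, hper, hper]
  have h2 : S.InRange (p + 1) q ((S.slidingIn p q)^[2] w) :=
    ⟨Δ_zpow_le_slidingIn_slidingIn hwr hspec, (hwr.iterate_slidingIn p q 2).2⟩
  rw [← hper2, Function.iterate_add_apply]
  exact (h2.iterate_slidingIn p q _).1

/-! ### Summit elements and cyclic sliding -/

theorem sliding_eq_slidingIn (y : G) :
    S.sliding y = S.slidingIn (S.inf y) (-S.inf y⁻¹) y := by
  rw [sliding, slidingIn, preferredPrefix_eq_prefixIn]

theorem preferredPrefix_inv (y : G) : S.preferredPrefix y⁻¹ = S.preferredPrefix y := by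
  rw [preferredPrefix, preferredPrefix, inv_inv, gcd_comm']

theorem sliding_inv (y : G) : S.sliding y⁻¹ = (S.sliding y)⁻¹ := by
  rw [sliding, sliding, preferredPrefix_inv, conj_inv]

theorem iterate_sliding_inv (y : G) (n : ℕ) : S.sliding^[n] y⁻¹ = (S.sliding^[n] y)⁻¹ := by
  induction n with
  | zero => rfl
  | succ n ih => rw [Function.iterate_succ_apply', ih, sliding_inv, Function.iterate_succ_apply']

theorem inRange_inf (hΔ : S.Δ ≠ 1) (y : G) : S.InRange (S.inf y) (-S.inf y⁻¹) y :=
  ⟨(Δ_zpow_le_iff hΔ).2 le_rfl, (le_Δ_zpow_iff_neg_inf_inv_le hΔ).2 le_rfl⟩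

theorem preferredPrefix_mem (hΔ : S.Δ ≠ 1) (y : G) : S.preferredPrefix y ∈ S.P := by
  rw [preferredPrefix_eq_prefixIn]
  exact prefixIn_mem (inRange_inf hΔ y)

theorem inf_le_inf_sliding (hΔ : S.Δ ≠ 1) (y : G) : S.inf y ≤ S.inf (S.sliding y) := by
  rw [← Δ_zpow_le_iff hΔ, sliding_eq_slidingIn]
  exact ((inRange_inf hΔ y).slidingIn _ _).1

theorem inf_le_inf_iterate_sliding (hΔ : S.Δ ≠ 1) (y : G) (n : ℕ) :
    S.inf y ≤ S.inf (S.sliding^[n] y) := by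
  induction n with
  | zero => rfl
  | succ n ih =>
    rw [Function.iterate_succ_apply']
    exact ih.trans (inf_le_inf_sliding hΔ _)

theorem inf_iterate_sliding_eq (hΔ : S.Δ ≠ 1) {y : G} {m : ℕ} (hm : 1 ≤ m)
    (hy : S.sliding^[m] y = y) (n : ℕ) : S.inf (S.sliding^[n] y) = S.inf y := by
  refine le_antisymm ?_ (inf_le_inf_iterate_sliding hΔ y n)
  have h1 : S.sliding^[m * n] y = y := by
    rw [Function.iterate_mul]
    exact Function.iterate_fixed hy n
  have h2 : m * n = (m * n - n) + n := (Nat.sub_add_cancel (Nat.le_mul_of_pos_left n hm)).symm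
  have h3 := inf_le_inf_iterate_sliding hΔ (S.sliding^[n] y) (m * n - n)
  rwa [← Function.iterate_add_apply, ← h2, h1] at h3

variable (S) in
/-- `y` has maximal infimum, and its inverse has maximal infimum, in their conjugacy classes; as
`inf y⁻¹ = -sup y`, this says that `y` lies in its super summit set. -/
def IsSummit (y : G) : Prop :=
  ∀ a : G, S.inf (conj y a) ≤ S.inf y ∧ S.inf (conj y a)⁻¹ ≤ S.inf y⁻¹

theorem inf_conj_le_of_iterate_sliding_eq (hΔ : S.Δ ≠ 1) {y : G} {m : ℕ} (hm : 1 ≤ m)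
    (hy : S.sliding^[m] y = y) (a : G) : S.inf (conj y a) ≤ S.inf y := by
  by_contra! hlt
  have hy' : S.sliding^[m] y⁻¹ = y⁻¹ := by rw [iterate_sliding_inv, hy]
  -- infimum and supremum are constant along the orbit, so that sliding there is `slidingIn p q`
  have hit : ∀ n, (S.slidingIn (S.inf y) (-S.inf y⁻¹))^[n] y = S.sliding^[n] y := by
    intro n
    induction n with
    | zero => rfl
    | succ n ih =>
      rw [Function.iterate_succ_apply', ih, Function.iterate_succ_apply', sliding_eq_slidingIn,
        inf_iterate_sliding_eq hΔ hm hy, ← iterate_sliding_inv, inf_iterate_sliding_eq hΔ hm hy']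
  obtain ⟨k, hk⟩ := exists_mul_Δ_pow_mem (S := S) a
  have hle : S.le (S.Δ ^ (S.inf y + 1)) (conj y (a * S.Δ ^ k)) := by
    rw [conj_mul, ← zpow_natCast, Δ_zpow_le_conj_Δ_zpow_iff, Δ_zpow_le_iff hΔ]
    omega
  have := Δ_zpow_le_of_iterate_slidingIn_eq (inRange_inf hΔ y) hm ((hit m).trans hy) hk hle
  rw [Δ_zpow_le_iff hΔ] at this
  omega

theorem isSummit_of_iterate_sliding_eq (hΔ : S.Δ ≠ 1) {y : G} {m : ℕ} (hm : 1 ≤ m)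
    (hy : S.sliding^[m] y = y) : S.IsSummit y := fun a =>
  ⟨inf_conj_le_of_iterate_sliding_eq hΔ hm hy a, by
    rw [← conj_inv]
    exact inf_conj_le_of_iterate_sliding_eq hΔ hm (by rw [iterate_sliding_inv, hy]) a⟩

theorem isSummit_of_mem_SSS (hΔ : S.Δ ≠ 1) {x : G} (hx : x ∈ S.SSS x) : S.IsSummit x := fun a => by
  rw [inf_inv_eq_neg_sup hΔ, inf_inv_eq_neg_sup hΔ, neg_le_neg_iff]
  exact ⟨hx.2.1 _ (isConj_conj x a), hx.2.2 _ (isConj_conj x a)⟩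

theorem IsSummit.sliding (hΔ : S.Δ ≠ 1) {x : G} (h : S.IsSummit x) :
    S.IsSummit (S.sliding x) := fun a => by
  have h1 := h (S.preferredPrefix x * a)
  rw [conj_mul] at h1
  have h2 := inf_le_inf_sliding hΔ x⁻¹
  rw [sliding_inv] at h2
  exact ⟨h1.1.trans (inf_le_inf_sliding hΔ x), h1.2.trans h2⟩

/-- The preferred prefix of a summit element is a prefix of every positive element conjugating it
to a rigid element. -/
theorem IsSummit.preferredPrefix_le {x α : G} (h : S.IsSummit x) (hα : α ∈ S.P)
    (hr : S.IsRigid (conj x α)) : S.le (S.preferredPrefix x) α := by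
  obtain ⟨h1, h2⟩ := h α
  rw [IsRigid, preferredPrefix_eq_prefixIn] at hr
  -- `α = α 𝔭(x ^ α)` is the greatest common divisor of `x α Δ ^ (-p)`, `α Δ` and `x⁻¹ α Δ ^ q`,
  -- where `p ≤ inf x` and `sup x ≤ q`
  rw [← mul_one α, ← hr, mul_prefixIn_conj, le_gcd_iff, le_gcd_iff]
  rw [preferredPrefix_eq_prefixIn]
  obtain ⟨e1, e2, e3⟩ := le_prefixIn_iff.1 (le_refl' (S.prefixIn (S.inf x) (-S.inf x⁻¹) x))
  refine ⟨⟨?_, ?_⟩, ?_⟩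
  · refine le_trans' e1 (le_trans' ((mul_le_mul_left_iff' x).2 (Δ_zpow_le_Δ_zpow ?_))
      (le_mul_Δ_zpow_of_mem _ hα))
    omega
  · refine le_trans' e2 ?_
    simpa using le_mul_Δ_zpow_of_mem (S := S) (a := 1) 1 hα
  · refine le_trans' e3 (le_trans' ((mul_le_mul_left_iff' x⁻¹).2 (Δ_zpow_le_Δ_zpow ?_))
      (le_mul_Δ_zpow_of_mem _ hα))
    omega

theorem iterate_sliding_eq_conj (x : G) (i : ℕ) :
    S.sliding^[i] x = conj x (S.slidingConjugator x i) := by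
  induction i with
  | zero => simp [conj, slidingConjugator]
  | succ i ih =>
    rw [Function.iterate_succ_apply', slidingConjugator, conj_mul, ← ih]
    rfl

theorem IsSummit.slidingConjugator_le (hΔ : S.Δ ≠ 1) {x α : G} (h : S.IsSummit x) (hα : α ∈ S.P)
    (hr : S.IsRigid (conj x α)) (i : ℕ) : S.le (S.slidingConjugator x i) α := by
  have hs : ∀ i, S.IsSummit (S.sliding^[i] x) := fun i => by
    induction i with
    | zero => exact h
    | succ i ih => rw [Function.iterate_succ_apply']; exact ih.sliding hΔ
  induction i with
  | zero => exact one_le_iff.2 hα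
  | succ i ih =>
    rw [slidingConjugator, mul_le_iff]
    refine (hs i).preferredPrefix_le ih ?_
    rwa [iterate_sliding_eq_conj, ← conj_mul, mul_inv_cancel_left]

theorem slidingConjugator_eq_prod (x : G) (i : ℕ) : S.slidingConjugator x i =
    ((List.range i).map fun j => S.preferredPrefix (S.sliding^[j] x)).prod := by
  induction i with
  | zero => rfl
  | succ i ih => rw [slidingConjugator, ih, List.prod_range_succ]

theorem slidingConjugator_mem (hΔ : S.Δ ≠ 1) (x : G) (i : ℕ) : S.slidingConjugator x i ∈ S.P := by
  induction i with
  | zero => exact S.P.one_mem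
  | succ i ih => exact S.P.mul_mem ih (preferredPrefix_mem hΔ _)

theorem IsRigid.sliding_eq {x : G} (h : S.IsRigid x) : S.sliding x = x := by
  rw [IsRigid] at h
  simp [sliding, conj, h]

theorem stable_of_isRigid_iterate {x : G} {M : ℕ} (h : S.IsRigid (S.sliding^[M] x)) {i : ℕ}
    (hi : M ≤ i) : S.slidingConjugator x i = S.slidingConjugator x M ∧
      S.sliding^[i] x = S.sliding^[M] x := by
  induction i, hi using Nat.le_induction with
  | base => exact ⟨rfl, rfl⟩
  | succ i _ ih =>
    rw [Function.iterate_succ_apply', slidingConjugator, ih.1, ih.2, h.sliding_eq]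
    rw [IsRigid] at h
    simp [h]

/-- Iterated sliding of a summit element reaches a rigid element if its conjugacy class contains
one: the products of preferred prefixes are all prefixes of one positive element. -/
theorem IsSummit.exists_isRigid_iterate (hΔ : S.Δ ≠ 1) {x α : G} (h : S.IsSummit x) (hα : α ∈ S.P)
    (hr : S.IsRigid (conj x α)) : ∃ M : ℕ, S.IsRigid (S.sliding^[M] x) := by
  by_contra! hno
  obtain ⟨N, hN⟩ := exists_length_le_of_prod_le hα
  have := hN ((List.range (N + 1)).map fun j => S.preferredPrefix (S.sliding^[j] x)) (by
    intro a ha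
    obtain ⟨j, -, rfl⟩ := List.mem_map.1 ha
    exact ⟨preferredPrefix_mem hΔ _, hno j⟩) (by
    rw [← slidingConjugator_eq_prod]
    exact h.slidingConjugator_le hΔ hα hr _)
  simp at this

theorem IsRigid.conj_Δ_pow {y : G} (h : S.IsRigid y) (k : ℕ) :
    S.IsRigid (conj y (S.Δ ^ k)) := by
  rw [← zpow_natCast]
  have e : S.inf (conj y (S.Δ ^ (k : ℤ)))⁻¹ = S.inf y⁻¹ := by rw [← conj_inv, inf_conj_Δ_zpow]
  rw [IsRigid, preferredPrefix_eq_prefixIn] at h ⊢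
  rw [e, inf_conj_Δ_zpow, ← mul_right_inj (S.Δ ^ (k : ℤ)), mul_prefixIn_conj, mul_one]
  have c : ∀ n : ℤ, S.Δ ^ (k : ℤ) * S.Δ ^ n = S.Δ ^ n * S.Δ ^ (k : ℤ) := fun n => by
    rw [← zpow_add, ← zpow_add, add_comm]
  have c1 := c 1
  rw [zpow_one] at c1
  rw [mul_assoc, mul_assoc, c, c, c1, ← mul_assoc, ← mul_assoc, gcd_mul_Δ_zpow, gcd_mul_Δ_zpow]
  rw [prefixIn, initialIn] at h
  rw [h, one_mul]

/-- A conjugator to a rigid element can be chosen positive. -/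
theorem exists_mem_isRigid_conj {x y : G} (h : IsConj x y) (hy : S.IsRigid y) :
    ∃ α ∈ S.P, S.IsRigid (conj x α) := by
  obtain ⟨a, rfl⟩ := exists_conj_eq h
  obtain ⟨k, hk⟩ := exists_mul_Δ_pow_mem (S := S) a
  exact ⟨_, hk, by rw [conj_mul]; exact hy.conj_Δ_pow k⟩

theorem SC_eq_setOf_isRigid (hΔ : S.Δ ≠ 1) {x : G} (hr : ∃ y : G, IsConj x y ∧ S.IsRigid y) :
    S.SC x = {y : G | IsConj x y ∧ S.IsRigid y} := by
  ext y
  refine ⟨fun ⟨hxy, m, hm, hy⟩ => ⟨hxy, ?_⟩, fun ⟨hxy, hy⟩ => ⟨hxy, 1, le_rfl, hy.sliding_eq⟩⟩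
  obtain ⟨z, hxz, hz⟩ := hr
  obtain ⟨α, hα, hrα⟩ := exists_mem_isRigid_conj (hxy.symm.trans hxz) hz
  obtain ⟨M, hM⟩ := (isSummit_of_iterate_sliding_eq hΔ hm hy).exists_isRigid_iterate hΔ hα hrα
  have h1 := (stable_of_isRigid_iterate hM (Nat.le_mul_of_pos_left M hm)).2
  have h2 : S.sliding^[m * M] y = y := by
    rw [Function.iterate_mul]
    exact Function.iterate_fixed hy M
  rwa [← h1, h2] at hM

theorem IsLeastPositiveConjugator.unique {x c c' : G} {A : Set G}
    (h : S.IsLeastPositiveConjugator x A c) (h' : S.IsLeastPositiveConjugator x A c') : c' = c :=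
  le_antisymm' (h'.2.2 c h.1 h.2.1) (h.2.2 c' h'.1 h'.2.1)

end GarsideStructure

theorem theoremT {G : Type*} [Group G] (S : GarsideStructure G) (hS : S.FiniteType)
    (x : G) (hx : x ∈ S.SSS x) (hr : ∃ y : G, IsConj x y ∧ S.IsRigid y) :
    S.SC x = {y : G | IsConj x y ∧ S.IsRigid y} ∧
    ∃ c : G,
      S.IsLeastPositiveConjugator x (S.SC x) c ∧
      (∀ c' : G, S.IsLeastPositiveConjugator x (S.SC x) c' → c' = c) ∧
      S.IsLeastPositiveConjugator x {y : G | IsConj x y ∧ S.IsRigid y} c ∧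
      ∃ M : ℕ, ∀ i : ℕ, M ≤ i →
        S.slidingConjugator x i = c ∧
        S.sliding^[i] x = GarsideStructure.conj x c ∧
        S.IsRigid (S.sliding^[i] x) := by
  by_cases hΔ : S.Δ = 1
  · -- the simple elements generate, so that `G` is trivial
    have := GarsideStructure.subsingleton_of_Δ_eq_one hΔ
    have hP : ∀ a : G, a ∈ S.P := fun a => Subsingleton.elim 1 a ▸ S.P.one_mem
    have hR : ∀ a : G, S.IsRigid a := fun a => Subsingleton.elim _ _
    have hSC : S.SC x = {y : G | IsConj x y ∧ S.IsRigid y} := by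
      ext y
      exact ⟨fun h => ⟨h.1, hR y⟩, fun h => ⟨h.1, 1, le_rfl, Subsingleton.elim _ _⟩⟩
    have hc : S.IsLeastPositiveConjugator x {y : G | IsConj x y ∧ S.IsRigid y} 1 :=
      ⟨hP 1, ⟨GarsideStructure.isConj_conj x 1, hR _⟩, fun α _ _ => hP _⟩
    exact ⟨hSC, 1, hSC ▸ hc, fun c' _ => Subsingleton.elim _ _, hc, 0,
      fun i _ => ⟨Subsingleton.elim _ _, Subsingleton.elim _ _, hR _⟩⟩
  · have hSC := GarsideStructure.SC_eq_setOf_isRigid hΔ hr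
    have hsum := GarsideStructure.isSummit_of_mem_SSS hΔ hx
    obtain ⟨y, hxy, hy⟩ := hr
    obtain ⟨α, hα, hrα⟩ := GarsideStructure.exists_mem_isRigid_conj hxy hy
    obtain ⟨M, hM⟩ := hsum.exists_isRigid_iterate hΔ hα hrα
    have hc : S.IsLeastPositiveConjugator x {y : G | IsConj x y ∧ S.IsRigid y}
        (S.slidingConjugator x M) :=
      ⟨GarsideStructure.slidingConjugator_mem hΔ x M,
        ⟨GarsideStructure.isConj_conj x _, GarsideStructure.iterate_sliding_eq_conj x M ▸ hM⟩,
        fun β hβ hrβ => hsum.slidingConjugator_le hΔ hβ hrβ.2 M⟩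
    refine ⟨hSC, _, hSC ▸ hc, fun c' hc' => hc.unique (hSC ▸ hc'), hc, M, fun i hi => ?_⟩
    obtain ⟨h1, h2⟩ := GarsideStructure.stable_of_isRigid_iterate hM hi
    exact ⟨h1, h2.trans (GarsideStructure.iterate_sliding_eq_conj x M), h2 ▸ hM⟩
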